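/- **Setting.** There are agents $\mathcal I=\{1,\dots,N\}$ and a variable $y=\mathrm{col}((y_p)_{p\in\mathcal P})$ with blocks $y_p\in\mathbb R^{n_p}$, $\mathcal P=\{1,\dots,P\}$. An interference graph $\mathcal E^I\subseteq\mathcal P\times\mathcal I$, in which every $p$ has at least one out-neighbor, says which blocks each cost depends on: agent $i$ has a proper, lower semicontinuous cost $f_i$ with values in $\mathbb R\cup\{\infty\}$, which is a function of $(y_p)_{p:(p,i)\in\mathcal E^I}$ only. (Every real-valued convex $f_i$ is proper and lower semicontinuous.) Let $\mathcal Y^\star$ be the set of minimizers over all $y$ of $f(y)=\sum_{i\in\mathcal I}f_i(y)$, assumed nonempty. Let $\mathcal E^E\supseteq\mathcal E^I$ be a fixed estimate graph, $\mathcal I_p=\{i:(p,i)\in\mathcal E^E\}$ the agents that estimate $y_p$, and $\mathcal P_i=\{p:(p,i)\in\mathcal E^E\}$ the blocks that agent $i$ estimates. At each time $k\in\mathbb N$ there are a directed communication graph on $\mathcal I$ and, for each $p$, a directed design graph $\mathcal G_p^k=(\mathcal I_p,\mathcal E_p^k)$ contained in it, with a weight matrix $W_p^k\in\mathbb R^{\mathcal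 I_p\times\mathcal I_p}$ satisfying $[W_p^k]_{i,j}>0$ if $(j,i)\in\mathcal E_p^k$ and $[W_p^k]_{i,j}=0$ otherwise. **Algorithm.** From arbitrary $z_{i,p}^0\in\mathbb R^{n_p}$ and $q_{i,p}^0=1$, every agent $i\in\mathcal I$ performs for all $p\in\mathcal P_i$ and $k\ge0$ $$q_{i,p}^{k+1}=\sum_{j\in\mathcal I_p}[W_p^k]_{i,j}\,q_{j,p}^k,\qquad w_{i,p}^{k+1}=\sum_{j\in\mathcal I_p}[W_p^k]_{i,j}\,z_{j,p}^k,\qquad y_{i,p}^{k+1}=\frac{w_{i,p}^{k+1}}{q_{i,p}^{k+1}},\qquad z_{i,p}^{k+1}=w_{i,p}^{k+1}-\gamma^k g_{i,p}^{k+1},$$ where $(g_{i,p}^{k+1})_{p\in\mathcal P_i}\in\partial f_i(\tilde y_i^{k+1})$ is a subgradient of $f_i$, as a function of $(y_p)_{p\in\mathcal P_i}$, at $\tilde y_i^{k+1}=(y_{i,p}^{k+1})_{p\in\mathcal P_i}$. **Theorem.** Assume that 1. there is $\nu>0$ such that for all $k$ and $p$: $(i,i)\in\mathcal E_p^k$ for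 all $i\in\mathcal I_p$; every column of $W_p^k$ sums to $1$; and $[W_p^k]_{i,j}\ge\nu$ whenever $(j,i)\in\mathcal E_p^k$; 2. there is an integer $Q>0$ such that for all $p$ and all $k\in\mathbb N$ the union graph $\bigcup_{t=kQ}^{(k+1)Q-1}\mathcal G_p^t$ is strongly connected; 3. each $f_i$ is convex, and there is $L>0$ such that $\|g\|\le L$ for all $y$ and all $g\in\partial f_i(y)$; 4. $(\gamma^k)_{k\in\mathbb N}$ is positive and non-increasing, with $\sum_{k=0}^\infty\gamma^k=\infty$ and $\sum_{k=0}^\infty(\gamma^k)^2<\infty$. Then there is $y^\star\in\mathcal Y^\star$ such that $y_{i,p}^k\to y_p^\star$ as $k\to\infty$ for all $p\in\mathcal P$ and $i\in\mathcal I_p$; that is, the stacked sequence $((y_{i,p}^k)_{i\in\mathcal I_p})_{p\in\mathcal P}$ converges to the consensus vector of $y^\star$. -/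

import Mathlib

open Filter Topology
open scoped RealInnerProductSpace

namespace END

/-! ### Convex analysis for functions with values in `ℝ ∪ {∞}` -/

/-- The subdifferential of `ψ` at `x`. -/
def subdifferential {X : Type*} [NormedAddCommGroup X] [InnerProductSpace ℝ X]
    (ψ : X → EReal) (x : X) : Set X :=
  {v | ∀ z, ψ x + ((⟪v, z - x⟫ : ℝ) : EReal) ≤ ψ z}

/-- `ψ` is proper: it never takes the value `-∞` and is not identically `∞`. -/
def IsProper {X : Type*} (ψ : X → EReal) : Prop :=
  (∀ x, ψ x ≠ ⊥) ∧ ∃ x, ψ x ≠ ⊤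

/-- An extended-valued function is convex when its epigraph is convex. -/
def IsConvex {X : Type*} [AddCommMonoid X] [Module ℝ X] (ψ : X → EReal) : Prop :=
  Convex ℝ {a : X × ℝ | ψ a.1 ≤ (a.2 : EReal)}

/-! ### Directed graphs -/

/-- Any vertex can be reached from any vertex along the edges of `G`. -/
def StronglyConnected {V : Type*} (G : Digraph V) : Prop :=
  ∀ u v, Relation.ReflTransGen G.Adj u v

/-- For all `k`, the union of `G t` over `kQ ≤ t ≤ (k+1)Q - 1` is strongly connected. -/
def QStronglyConnected {V : Type*} (Q : ℕ) (G : ℕ → Digraph V) : Prop :=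
  ∀ k : ℕ, StronglyConnected (⨆ t : Set.Ico (k * Q) ((k + 1) * Q), G t)

/-- `W` is compliant with `G`: `W u v > 0` if `(v, u)` is an edge, and `W u v = 0` otherwise. -/
def Compliant {V : Type*} (G : Digraph V) (W : Matrix V V ℝ) : Prop :=
  ∀ u v, (G.Adj v u → 0 < W u v) ∧ (¬ G.Adj v u → W u v = 0)

/-! ### Block variables, and the estimates prescribed by a bipartite graph

There are `N` agents and `P` blocks, and block `p` has dimension `n p`.  A bipartite graph from
blocks to agents is given by its edge set `E : Finset (Fin P × Fin N)`. -/

variable {N P : ℕ}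

/-- The out-neighbors of the block `p`, i.e. the agents `i` with `(p, i) ∈ E`. -/
abbrev Agents (E : Finset (Fin P × Fin N)) (p : Fin P) : Type := {i : Fin N // (p, i) ∈ E}

/-- The in-neighbors of the agent `i`, i.e. the blocks `p` with `(p, i) ∈ E`. -/
abbrev Blocks (E : Finset (Fin P × Fin N)) (i : Fin N) : Type := {p : Fin P // (p, i) ∈ E}

/-- The whole variable `y = (y_p)_p`, with its Euclidean norm. -/
abbrev Var (n : Fin P → ℕ) : Type := PiLp 2 fun p : Fin P => EuclideanSpace ℝ (Fin (n p))

/-- The vectors `(y_p)_p`, where `p` ranges over the in-neighbors of agent `i` only. -/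
abbrev LocalVar (n : Fin P → ℕ) (E : Finset (Fin P × Fin N)) (i : Fin N) : Type :=
  PiLp 2 fun p : Blocks E i => EuclideanSpace ℝ (Fin (n p.1))

/-- Stacked block-wise data `(y_{i,p})`: one vector for each block `p` and each agent `i` that
estimates `p`. -/
abbrev Estimates (n : Fin P → ℕ) (E : Finset (Fin P × Fin N)) : Type :=
  (p : Fin P) → Agents E p → EuclideanSpace ℝ (Fin (n p))

/-- All data kept by agent `i`, i.e. `(y_{i,p})_p` with `p` ranging over the blocks that `i`
estimates. -/
def agentPart {n : Fin P → ℕ} {E : Finset (Fin P × Fin N)} (y : Estimates n E) (i : Fin N) :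
    LocalVar n E i :=
  WithLp.toLp 2 fun p => y p.1 ⟨i, p.2⟩

/-- The consensus vector of `y`: every estimate of block `p` equals `y_p`. -/
def consensus {n : Fin P → ℕ} (E : Finset (Fin P × Fin N)) (y : Var n) : Estimates n E :=
  fun p _ => y p

/-! ### The cost functions

The cost `f i` is a function of the blocks that interfere with agent `i`. -/

/-- `f i` as a function of the whole variable. -/
def fullCost {n : Fin P → ℕ} {EI : Finset (Fin P × Fin N)}
    (f : (i : Fin N) → LocalVar n EI i → EReal) (i : Fin N) (y : Var n) : EReal :=
  f i (WithLp.toLp 2 fun p => y p.1)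

/-- `f i` as a function of the blocks that agent `i` estimates. -/
def estimateCost {n : Fin P → ℕ} {EI EE : Finset (Fin P × Fin N)} (h : EI ⊆ EE)
    (f : (i : Fin N) → LocalVar n EI i → EReal) (i : Fin N) (y : LocalVar n EE i) : EReal :=
  f i (WithLp.toLp 2 fun p => y ⟨p.1, h p.2⟩)

/-- The solution set of the problem of minimizing `∑ i, f i` over the whole space. -/
def solutionSet {n : Fin P → ℕ} {EI : Finset (Fin P × Fin N)}
    (f : (i : Fin N) → LocalVar n EI i → EReal) : Set (Var n) :=
  {y | ∀ u, ∑ i, fullCost f i y ≤ ∑ i, fullCost f i u}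

/-! ### The assumptions on the weights, and the algorithm -/

/-- Self-loops, column-stochasticity and finite weights (with lower bound `ν`), at all times and
for all blocks. -/
structure ColumnStochasticWeights {EE : Finset (Fin P × Fin N)} (ν : ℝ)
    (GD : ℕ → (p : Fin P) → Digraph (Agents EE p))
    (W : ℕ → (p : Fin P) → Matrix (Agents EE p) (Agents EE p) ℝ) : Prop where
  self_loop : ∀ k p i, (GD k p).Adj i i
  col_sum : ∀ k p j, ∑ i, W k p i j = 1
  lower_bound : ∀ k p i j, (GD k p).Adj j i → ν ≤ W k p i j

/-- The sequences `q, w, g, y, z` satisfy the push-sum subgradient recursion with weight matrices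
`W` and step sizes `γ`, started from `q = 1` and an arbitrary `z 0`.  The stacked vector
`(g_{i,p})_p` of agent `i` is a subgradient of its cost at its current estimates, so that each
`g_{i,p}` is the component along `y_p` of a subgradient.  The values `w 0`, `g 0`, `y 0` play no
role. -/
structure IsPushSum {n : Fin P → ℕ} {EI EE : Finset (Fin P × Fin N)} (h : EI ⊆ EE)
    (f : (i : Fin N) → LocalVar n EI i → EReal)
    (W : ℕ → (p : Fin P) → Matrix (Agents EE p) (Agents EE p) ℝ) (γ : ℕ → ℝ)
    (q : ℕ → (p : Fin P) → Agents EE p → ℝ) (w g y z : ℕ → Estimates n EE) : Prop where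
  q_zero : ∀ p i, q 0 p i = 1
  q_succ : ∀ k p i, q (k + 1) p i = ∑ j, W k p i j * q k p j
  w_succ : ∀ k p i, w (k + 1) p i = ∑ j, W k p i j • z k p j
  y_succ : ∀ k p i, y (k + 1) p i = (q (k + 1) p i)⁻¹ • w (k + 1) p i
  g_succ : ∀ k i, agentPart (g (k + 1)) i ∈
    subdifferential (estimateCost h f i) (agentPart (y (k + 1)) i)
  z_succ : ∀ k p i, z (k + 1) p i = w (k + 1) p i - γ k • g (k + 1) p i

end END

/-! Column-stochastic weights preserve block sums, so the block averages of `z` perform a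
subgradient step: `x_p ← x_p - γ |I_p|⁻¹ ∑ i, g_{i,p}`. The factors `|I_p|⁻¹` differ between blocks.
Measuring distance to a minimizer `u` by `∑ p, |I_p| ‖x_p - u_p‖²` cancels them, and the cross terms
regroup by agent into `∑ i, ⟪g_i, x - u⟫`. This is at least `f x - f u` up to an error linear in the
disagreement `D` between estimates and averages (`weightedSqDist_average_le`).

Disagreement: the ratios `z / q` follow a row-stochastic averaging whose perturbation is `O(γ)`,
because `q` stays bounded away from zero. Joint connectivity makes their spread contract over a
fixed number of steps, so `D` is square summable (`exists_pushSum_error`) and `γ * D` is summable.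

The weighted distances to every minimizer therefore converge and `γ * (f x - f u)` is summable. As
`γ` is not summable, near-optimal values recur, and a Fejér argument gives one limit
(`exists_tendsto_of_fejer`).

Bounded subgradients make the extended-valued costs finite and Lipschitz, by way of proximal points
(`exists_real_lipschitz`). -/

namespace END

/-! ### Bounded subgradients force finiteness and Lipschitz continuity -/

section Convex

variable {X : Type*} [NormedAddCommGroup X] [InnerProductSpace ℝ X]

lemma IsConvex.le_combo {ψ : X → EReal} (hψ : IsConvex ψ) {x z : X} {a b t : ℝ}
    (hx : ψ x ≤ a) (hz : ψ z ≤ b) (h0 : 0 ≤ t) (h1 : t ≤ 1) :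
    ψ (x + t • (z - x)) ≤ ((a + t * (b - a) : ℝ) : EReal) := by
  have h := hψ (show (x, a) ∈ _ from hx) (show (z, b) ∈ _ from hz) (sub_nonneg.2 h1) h0
    (sub_add_cancel 1 t)
  have e : (1 - t) • (x, a) + t • (z, b) = (x + t • (z - x), a + t * (b - a)) := by
    ext1
    · simp only [Prod.fst_add, Prod.smul_fst]; module
    · simp only [Prod.snd_add, Prod.smul_snd, smul_eq_mul]; ring
  rw [e] at h
  exact h

/-- A proper lower semicontinuous convex function decreases at most linearly. -/
lemma exists_linear_lower_bound [ProperSpace X] {ψ : X → EReal} (hlsc : LowerSemicontinuous ψ)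
    (hbot : ∀ x, ψ x ≠ ⊥) (hconv : IsConvex ψ) {x₀ : X} {a : ℝ} (ha : ψ x₀ = a) :
    ∃ M : ℝ, 0 ≤ M ∧ ∀ z (s : ℝ), ψ z ≤ s → a - M - M * ‖z - x₀‖ ≤ s := by
  obtain ⟨u, -, hu⟩ := (hlsc.lowerSemicontinuousOn (Metric.closedBall x₀ 1)).exists_isMinOn
    ⟨x₀, by simp⟩ (isCompact_closedBall x₀ 1)
  have hux : ψ u ≤ a := ha ▸ hu (show x₀ ∈ Metric.closedBall x₀ 1 by simp)
  obtain ⟨m, hm⟩ : ∃ m : ℝ, ψ u = m :=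
    ⟨(ψ u).toReal, (EReal.coe_toReal (ne_top_of_le_ne_top (EReal.coe_ne_top a) hux) (hbot u)).symm⟩
  have hma : m ≤ a := by rw [hm] at hux; exact_mod_cast hux
  have key : ∀ z (s : ℝ), ‖z - x₀‖ ≤ 1 → ψ z ≤ s → m ≤ s := fun z s hz hs => by
    have h : ψ u ≤ ψ z := hu (show z ∈ Metric.closedBall x₀ 1 by simpa [dist_eq_norm] using hz)
    rw [hm] at h
    exact_mod_cast h.trans hs
  refine ⟨a - m, by linarith, fun z s hs => ?_⟩
  rcases le_or_gt ‖z - x₀‖ 1 with h | h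
  · nlinarith [key z s h hs, norm_nonneg (z - x₀)]
  · have hpos : 0 < ‖z - x₀‖ := by linarith
    -- The point of the segment from `x₀` to `z` at distance one from `x₀` has value at least `m`,
    -- and convexity bounds that value above.
    have h2 := key _ _ (by
      rw [add_sub_cancel_left, norm_smul, norm_inv, norm_norm, inv_mul_cancel₀ hpos.ne'])
      (hconv.le_combo ha.le hs (inv_nonneg.2 hpos.le) (inv_le_one_of_one_le₀ h.le))
    have h3 : ‖z - x₀‖ * m ≤ ‖z - x₀‖ * a + (s - a) := by
      calc _ ≤ ‖z - x₀‖ * (a + ‖z - x₀‖⁻¹ * (s - a)) := mul_le_mul_of_nonneg_left h2 hpos.le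
        _ = _ := by field_simp
    nlinarith

/-- The proximal point of a proper lower semicontinuous convex function exists. -/
lemma exists_proximal_point [ProperSpace X] {ψ : X → EReal} (hlsc : LowerSemicontinuous ψ)
    (hproper : IsProper ψ) (hconv : IsConvex ψ) (y : X) {c : ℝ} (hc : 0 < c) :
    ∃ x, ∃ r : ℝ, ψ x = r ∧
      ∀ z (s : ℝ), ψ z ≤ s → r + c * ‖x - y‖ ^ 2 ≤ s + c * ‖z - y‖ ^ 2 := by
  obtain ⟨hbot, x₀, hx₀⟩ := hproper
  obtain ⟨a, ha⟩ : ∃ a : ℝ, ψ x₀ = a := ⟨_, (EReal.coe_toReal hx₀ (hbot x₀)).symm⟩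
  obtain ⟨M, hM, hlow⟩ := exists_linear_lower_bound hlsc hbot hconv ha
  set d := ‖x₀ - y‖ with hd
  have hd0 : 0 ≤ d := norm_nonneg _
  -- Beyond this radius the quadratic term outweighs the linear decrease of `ψ`, so a minimizer on
  -- the ball is global.
  set R := 1 + 2 * d + 2 * M / c with hR
  have hMc : 0 ≤ 2 * M / c := by positivity
  have hR0 : 0 ≤ R := by positivity
  have hH : LowerSemicontinuous fun x => ψ x + ((c * ‖x - y‖ ^ 2 : ℝ) : EReal) := by
    refine hlsc.add' (Continuous.lowerSemicontinuous (by
      exact continuous_coe_real_ereal.comp (by fun_prop))) fun x => ?_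
    exact EReal.continuousAt_add (Or.inr (EReal.coe_ne_bot _)) (Or.inr (EReal.coe_ne_top _))
  obtain ⟨x, -, hx⟩ := (hH.lowerSemicontinuousOn (Metric.closedBall x₀ R)).exists_isMinOn
    ⟨x₀, by simpa using hR0⟩ (isCompact_closedBall x₀ R)
  have hxx : ∀ z ∈ Metric.closedBall x₀ R,
      ψ x + ((c * ‖x - y‖ ^ 2 : ℝ) : EReal) ≤ ψ z + ((c * ‖z - y‖ ^ 2 : ℝ) : EReal) :=
    fun z hz => hx hz
  have h0 := hxx x₀ (by simpa using hR0)
  obtain ⟨r, hr⟩ : ∃ r : ℝ, ψ x = r := by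
    refine ⟨_, (EReal.coe_toReal (fun h => ?_) (hbot x)).symm⟩
    rw [h, ha, EReal.top_add_coe, ← EReal.coe_add] at h0
    exact EReal.coe_ne_top _ (top_le_iff.1 h0)
  refine ⟨x, r, hr, fun z s hs => ?_⟩
  rcases le_or_gt ‖z - x₀‖ R with h | h
  · have h1 := (hxx z (by simpa [dist_eq_norm] using h)).trans (add_le_add_left hs _)
    rw [hr] at h1
    exact_mod_cast h1
  · rw [hr, ha] at h0
    have h0' : r + c * ‖x - y‖ ^ 2 ≤ a + c * d ^ 2 := by exact_mod_cast h0
    have h2 := hlow z s hs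
    set ρ := ‖z - x₀‖
    have h3 : ρ - d ≤ ‖z - y‖ := by
      have := norm_sub_le (z - y) (x₀ - y)
      rw [sub_sub_sub_cancel_right] at this
      linarith
    have h4 : (ρ - d) ^ 2 ≤ ‖z - y‖ ^ 2 := pow_le_pow_left₀ (by linarith) h3 2
    have h5 : c * (ρ - d) ^ 2 ≤ c * ‖z - y‖ ^ 2 := mul_le_mul_of_nonneg_left h4 hc.le
    have h6 : 2 * M ≤ c * (ρ - 2 * d) := by
      have : 2 * M / c ≤ ρ - 2 * d := by linarith
      rwa [div_le_iff₀' hc] at this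
    have h7 : 2 * M * ρ ≤ c * (ρ - 2 * d) * ρ := mul_le_mul_of_nonneg_right h6 (by linarith)
    have h8 : M * 1 ≤ M * ρ := mul_le_mul_of_nonneg_left (by linarith) hM
    nlinarith

/-- A proximal point yields a subgradient. -/
lemma smul_sub_mem_subdifferential {ψ : X → EReal} (hbot : ∀ x, ψ x ≠ ⊥) (hconv : IsConvex ψ)
    {x y : X} {r c : ℝ} (hr : ψ x = r)
    (h : ∀ z (s : ℝ), ψ z ≤ s → r + c * ‖x - y‖ ^ 2 ≤ s + c * ‖z - y‖ ^ 2) :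
    (2 * c) • (y - x) ∈ subdifferential ψ x := by
  intro z
  by_cases hz : ψ z = ⊤
  · rw [hz]; exact le_top
  obtain ⟨s, hs⟩ : ∃ s : ℝ, ψ z = s := ⟨_, (EReal.coe_toReal hz (hbot z)).symm⟩
  rw [hr, hs]
  norm_cast
  -- Comparison with `x + t • (z - x)`, divided by `t`; the remaining quadratic term vanishes as `t
  -- → 0`.
  have key : ∀ t : ℝ, 0 < t → t ≤ 1 →
      r + ⟪(2 * c) • (y - x), z - x⟫ ≤ s + t * (c * ‖z - x‖ ^ 2) := by
    intro t h0 h1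
    have h2 := h _ _ (hconv.le_combo hr.le hs.le h0.le h1)
    have e : x + t • (z - x) - y = (x - y) + t • (z - x) := by abel
    rw [e, norm_add_sq_real, norm_smul, inner_smul_right, mul_pow, Real.norm_eq_abs, sq_abs] at h2
    have e2 : ⟪(2 * c) • (y - x), z - x⟫ = -(2 * c * ⟪x - y, z - x⟫) := by
      rw [inner_smul_left, ← neg_sub x y, inner_neg_left]; simp
    rw [e2]
    have h3 : t * (r + -(2 * c * ⟪x - y, z - x⟫)) ≤ t * (s + t * (c * ‖z - x‖ ^ 2)) := by
      nlinarith
    exact le_of_mul_le_mul_left h3 h0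
  have hlim : Tendsto (fun t : ℝ => s + t * (c * ‖z - x‖ ^ 2)) (𝓝[>] 0) (𝓝 s) := by
    have : Continuous fun t : ℝ => s + t * (c * ‖z - x‖ ^ 2) := by fun_prop
    simpa using (this.tendsto 0).mono_left nhdsWithin_le_nhds
  refine ge_of_tendsto hlim ?_
  filter_upwards [Ioc_mem_nhdsGT (zero_lt_one' ℝ)] with t ht using key t ht.1 ht.2

/-- A proper lower semicontinuous convex function with bounded subgradients is finite and
Lipschitz. -/
theorem exists_real_lipschitz [ProperSpace X] {ψ : X → EReal} (hlsc : LowerSemicontinuous ψ)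
    (hproper : IsProper ψ) (hconv : IsConvex ψ) {L : ℝ} (hL : 0 < L)
    (hbdd : ∀ x, ∀ g ∈ subdifferential ψ x, ‖g‖ ≤ L) :
    ∃ F : X → ℝ, (∀ x, ψ x = F x) ∧ ∀ x y, F x ≤ F y + L * ‖x - y‖ := by
  have key : ∀ x y (s : ℝ), ψ y ≤ s → ψ x ≤ ((s + L * ‖x - y‖ : ℝ) : EReal) := by
    intro x y s hs
    by_contra! hlt
    obtain ⟨r, hr1, hr2⟩ := EReal.lt_iff_exists_real_btwn.1 hlt
    have hr1 : s + L * ‖x - y‖ < r := by exact_mod_cast hr1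
    obtain ⟨ε, hε, hball⟩ := Metric.eventually_nhds_iff.1 (hlsc x _ hr2)
    -- The proximal point `u` has the subgradient `(L / δ) • (x - u)`, so the bound `L` gives `‖x -
    -- u‖ ≤ δ`. The first entry of the minimum then forces `ψ u > r`; the second makes the
    -- subgradient inequality at `y` give `ψ u ≤ r`.
    set δ := min (ε / 2) ((r - (s + L * ‖x - y‖)) / L) with hδ
    have hδ0 : 0 < δ := lt_min (by linarith) (div_pos (by linarith) hL)
    have hc : 0 < L / (2 * δ) := by positivity
    obtain ⟨u, a, hua, hu⟩ := exists_proximal_point hlsc hproper hconv x hc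
    have hsub := smul_sub_mem_subdifferential hproper.1 hconv hua hu
    have hnorm := hbdd u _ hsub
    have hux : ‖x - u‖ ≤ δ := by
      rw [norm_smul, Real.norm_of_nonneg (by positivity)] at hnorm
      have e : 2 * (L / (2 * δ)) * ‖x - u‖ = L * (‖x - u‖ / δ) := by field_simp
      rw [e] at hnorm
      have := le_of_mul_le_mul_left (hnorm.trans_eq (mul_one L).symm) hL
      rwa [div_le_one hδ0] at this
    have h1 := (hsub y).trans hs
    rw [hua] at h1
    have h1 : a + ⟪(2 * (L / (2 * δ))) • (x - u), y - u⟫ ≤ s := by exact_mod_cast h1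
    have h2 : (r : EReal) < ψ u := hball (by
      rw [dist_comm, dist_eq_norm]; linarith [min_le_left (ε / 2) ((r - (s + L * ‖x - y‖)) / L)])
    rw [hua] at h2
    have h2 : r < a := EReal.coe_lt_coe_iff.1 h2
    have h3 := neg_le_of_abs_le (abs_real_inner_le_norm ((2 * (L / (2 * δ))) • (x - u)) (y - u))
    have h4 : ‖y - u‖ ≤ ‖x - y‖ + δ := by
      calc ‖y - u‖ = ‖(y - x) + (x - u)‖ := by rw [sub_add_sub_cancel]
        _ ≤ _ := (norm_add_le _ _).trans (by rw [norm_sub_rev y x]; linarith)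
    have h5 : L * δ ≤ r - (s + L * ‖x - y‖) := by
      rw [← le_div_iff₀' hL]; exact min_le_right _ _
    have h6 := mul_le_mul hnorm h4 (norm_nonneg _) hL.le
    linarith
  obtain ⟨hbot, x₀, hx₀⟩ := hproper
  have hfin : ∀ x, ψ x ≠ ⊤ := fun x => ne_top_of_le_ne_top (EReal.coe_ne_top _)
    (key x x₀ _ (EReal.coe_toReal hx₀ (hbot x₀)).ge)
  have hF : ∀ x, ψ x = (ψ x).toReal := fun x => (EReal.coe_toReal (hfin x) (hbot x)).symm
  refine ⟨fun x => (ψ x).toReal, hF, fun x y => ?_⟩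
  have h := key x y _ (hF y).le
  rw [hF x] at h
  exact_mod_cast h

end Convex

/-! ### Diameter of a finite family -/

section Spread

variable {V : Type*} {E : Type*} [NormedAddCommGroup E]

/-- The largest distance between two members of a finite family. -/
noncomputable def spread (x : V → E) : ℝ := ⨆ ij : V × V, ‖x ij.1 - x ij.2‖

lemma norm_sub_le_spread [Finite V] (x : V → E) (i j : V) : ‖x i - x j‖ ≤ spread x :=
  le_ciSup (f := fun ij : V × V => ‖x ij.1 - x ij.2‖) (Set.finite_range _).bddAbove (i, j)

lemma spread_nonneg (x : V → E) : 0 ≤ spread x := Real.iSup_nonneg fun _ => norm_nonneg _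

lemma spread_le [Nonempty V] {x : V → E} {D : ℝ} (h : ∀ i j, ‖x i - x j‖ ≤ D) : spread x ≤ D :=
  ciSup_le fun ij => h ij.1 ij.2

end Spread

/-! ### Contraction over jointly connected graphs, and push-sum -/

section Consensus

variable {V : Type*} [Fintype V] {E : Type*} [NormedAddCommGroup E] [NormedSpace ℝ E]

/-- A quantity that passes along edges with a loss factor `β` per step reaches every vertex within
`(card V + 1) * Q` steps. -/
lemma pow_mul_le_of_qStronglyConnected {G : ℕ → Digraph V} {Q : ℕ} (hQ : 0 < Q)
    (hconn : QStronglyConnected Q G) (hself : ∀ t i, (G t).Adj i i) {β : ℝ} (hβ : 0 ≤ β) (s : ℕ)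
    {v : ℕ → V → ℝ} (hstep : ∀ m i j, (G (s + m)).Adj j i → β * v m j ≤ v (m + 1) i) (i j : V) :
    β ^ ((Fintype.card V + 1) * Q) * v 0 j ≤ v ((Fintype.card V + 1) * Q) i := by
  classical
  let S : ℕ → Finset V := fun m => {i | β ^ m * v 0 j ≤ v m i}
  have hS : ∀ m i, i ∈ S m ↔ β ^ m * v 0 j ≤ v m i := fun m i => by simp [S]
  have hedge : ∀ m i l, (G (s + m)).Adj l i → l ∈ S m → i ∈ S (m + 1) := fun m i l hG hl => by
    rw [hS] at hl ⊢
    calc β ^ (m + 1) * v 0 j = β * (β ^ m * v 0 j) := by ring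
      _ ≤ β * v m l := mul_le_mul_of_nonneg_left hl hβ
      _ ≤ _ := hstep m i l hG
  have hmono : Monotone S := monotone_nat_of_le_succ fun m i hi => hedge m i i (hself _ i) hi
  have hj : j ∈ S 0 := by simp [hS]
  -- If the reached set does not grow during an aligned window, it is closed under the edges of the
  -- union graph, hence everything.
  have hgrow : ∀ m k, s + m = k * Q → S (m + Q) ⊆ S m → S m = Finset.univ := by
    intro m k hk hsub
    refine Finset.eq_univ_of_forall fun u => ?_
    have hju := hconn k j u
    induction hju with
    | refl => exact hmono (Nat.zero_le m) hj
    | @tail a b _ hab ih =>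
      obtain ⟨⟨t, ht⟩, hadj⟩ := Digraph.iSup_adj.1 hab
      rw [Set.mem_Ico, add_mul, one_mul] at ht
      obtain ⟨r, rfl⟩ : ∃ r, t = s + r := ⟨t - s, by omega⟩
      exact hsub (hmono (by omega) (hedge r b a hadj (hmono (by omega) ih)))
  -- Waiting for the next multiple of `Q` costs at most one window, whence the `+ 1` in `card V +
  -- 1`.
  obtain ⟨m₀, hm₀, hm₀Q⟩ : ∃ m₀, s + m₀ = (s / Q + 1) * Q ∧ m₀ ≤ Q := by
    have h1 := Nat.div_add_mod s Q
    have h2 := Nat.mod_lt s hQ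
    rw [mul_comm] at h1
    refine ⟨Q - s % Q, ?_, Nat.sub_le _ _⟩
    rw [add_mul, one_mul]
    omega
  have hcard : ∀ l, l < (S (m₀ + l * Q)).card ∨ S (m₀ + l * Q) = Finset.univ := by
    intro l
    induction l with
    | zero => exact Or.inl (Finset.card_pos.2 ⟨j, hmono (Nat.zero_le _) hj⟩)
    | succ l ih =>
      have hle : m₀ + l * Q ≤ m₀ + (l + 1) * Q := by gcongr; omega
      by_cases hsub : S (m₀ + l * Q + Q) ⊆ S (m₀ + l * Q)
      · have := hgrow (m₀ + l * Q) (s / Q + 1 + l) (by rw [← add_assoc, hm₀]; ring) hsub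
        exact Or.inr (Finset.univ_subset_iff.1 (this ▸ hmono hle))
      · rcases ih with ih | ih
        · have := Finset.card_lt_card
            ((Finset.ssubset_iff_subset_ne.2 ⟨hmono (Nat.le_add_right (m₀ + l * Q) Q), fun h =>
              hsub h.ge⟩))
          rw [show m₀ + (l + 1) * Q = m₀ + l * Q + Q by ring]
          exact Or.inl (by omega)
        · exact Or.inr (Finset.univ_subset_iff.1 (ih ▸ hmono hle))
  have huniv : S (m₀ + Fintype.card V * Q) = Finset.univ :=
    (hcard _).resolve_left (not_lt.2 (Finset.card_le_univ _))
  have hle : m₀ + Fintype.card V * Q ≤ (Fintype.card V + 1) * Q := by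
    rw [add_mul, one_mul]; omega
  exact (hS _ i).1 (hmono hle (huniv ▸ Finset.mem_univ i))

lemma norm_sum_smul_sub_le {a : V → ℝ} (ha : ∀ i, 0 ≤ a i) (h1 : ∑ i, a i = 1) {x : V → E}
    {u : E} {D : ℝ} (hD : ∀ i, ‖x i - u‖ ≤ D) : ‖∑ i, a i • x i - u‖ ≤ D := by
  have e : ∑ i, a i • x i - u = ∑ i, a i • (x i - u) := by
    simp only [smul_sub, Finset.sum_sub_distrib, ← Finset.sum_smul, h1, one_smul]
  rw [e]
  calc _ ≤ ∑ i, a i * D := norm_sum_le_of_le _ fun i _ => by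
        rw [norm_smul, Real.norm_of_nonneg (ha i)]
        exact mul_le_mul_of_nonneg_left (hD i) (ha i)
    _ = D := by rw [← Finset.sum_mul, h1, one_mul]

lemma norm_sum_smul_sub_sum_smul_le {a b : V → ℝ} (ha : ∀ i, 0 ≤ a i) (hb : ∀ i, 0 ≤ b i)
    (ha1 : ∑ i, a i = 1) (hb1 : ∑ i, b i = 1) {x : V → E} {D : ℝ}
    (hD : ∀ i j, ‖x i - x j‖ ≤ D) : ‖∑ i, a i • x i - ∑ i, b i • x i‖ ≤ D := by
  refine norm_sum_smul_sub_le ha ha1 fun i => ?_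
  rw [norm_sub_rev]
  exact norm_sum_smul_sub_le hb hb1 fun j => hD j i

/-- Two convex combinations that share the weight `η` at one point are closer by a factor
`1 - η`. -/
lemma norm_sum_smul_sub_sum_smul_le_mul {a b : V → ℝ} (ha : ∀ i, 0 ≤ a i) (hb : ∀ i, 0 ≤ b i)
    (ha1 : ∑ i, a i = 1) (hb1 : ∑ i, b i = 1) {x : V → E} {D : ℝ}
    (hD : ∀ i j, ‖x i - x j‖ ≤ D) {η : ℝ} (l : V) (hal : η ≤ a l) (hbl : η ≤ b l) :
    ‖∑ i, a i • x i - ∑ i, b i • x i‖ ≤ (1 - η) * D := by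
  classical
  -- Remove the common mass `η` at `l`; it cancels in the difference, and the remainders, of mass `1
  -- - η`, are rescaled to convex combinations.
  have red : ∀ c : V → ℝ, (∀ i, 0 ≤ c i) → ∑ i, c i = 1 → η ≤ c l →
      ∃ c' : V → ℝ, (∀ i, 0 ≤ c' i) ∧ ∑ i, c' i = 1 - η ∧
        ∑ i, c i • x i = ∑ i, c' i • x i + η • x l := by
    intro c hc hc1 hcl
    refine ⟨fun i => c i - if i = l then η else 0, fun i => ?_, ?_, ?_⟩
    · dsimp only
      split_ifs with h
      · subst h; linarith
      · linarith [hc i]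
    · simp [hc1]
    · simp [sub_smul, ite_smul]
  obtain ⟨a', ha', ha1', hax⟩ := red a ha ha1 hal
  obtain ⟨b', hb', hb1', hbx⟩ := red b hb hb1 hbl
  rw [hax, hbx, add_sub_add_right_eq_sub]
  rcases eq_or_ne (1 - η) 0 with h | h
  · rw [h] at ha1' hb1' ⊢
    rw [Finset.sum_eq_zero_iff_of_nonneg fun i _ => ha' i] at ha1'
    rw [Finset.sum_eq_zero_iff_of_nonneg fun i _ => hb' i] at hb1'
    simp [ha1', hb1']
  · have hpos : 0 < 1 - η := lt_of_le_of_ne (ha1' ▸ Finset.sum_nonneg fun i _ => ha' i) h.symm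
    have key := norm_sum_smul_sub_sum_smul_le (a := fun i => (1 - η)⁻¹ * a' i)
      (b := fun i => (1 - η)⁻¹ * b' i) (fun i => mul_nonneg (inv_nonneg.2 hpos.le) (ha' i))
      (fun i => mul_nonneg (inv_nonneg.2 hpos.le) (hb' i))
      (by rw [← Finset.mul_sum, ha1', inv_mul_cancel₀ h])
      (by rw [← Finset.mul_sum, hb1', inv_mul_cancel₀ h]) hD
    simp only [mul_smul, ← Finset.smul_sum, ← smul_sub] at key
    rwa [norm_smul, norm_inv, Real.norm_of_nonneg hpos.le, inv_mul_le_iff₀ hpos] at key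

/-- Summing the recursion, the shifted sum misses only the first `T` terms, so `η` times any partial
sum of `a` is at most those terms plus `∑' k, b k`. -/
lemma summable_of_delayed_contraction {a b : ℕ → ℝ} {T : ℕ} {η : ℝ} (ha : ∀ k, 0 ≤ a k)
    (hb : ∀ k, 0 ≤ b k) (hbs : Summable b) (hη : 0 < η)
    (h : ∀ k, a (k + T) ≤ (1 - η) * a k + b k) : Summable a := by
  refine summable_of_sum_range_le (c := (∑ k ∈ Finset.range T, a k + ∑' k, b k) / η) ha fun K => ?_
  rw [le_div_iff₀ hη]
  have h1 : ∑ k ∈ Finset.range K, a k ≤ ∑ k ∈ Finset.range (T + K), a k :=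
    Finset.sum_le_sum_of_subset_of_nonneg (Finset.range_mono (Nat.le_add_left K T))
      fun k _ _ => ha k
  rw [Finset.sum_range_add] at h1
  have h2 : ∑ k ∈ Finset.range K, a (T + k) ≤
      (1 - η) * ∑ k ∈ Finset.range K, a k + ∑ k ∈ Finset.range K, b k := by
    rw [Finset.mul_sum, ← Finset.sum_add_distrib]
    exact Finset.sum_le_sum fun k _ => by rw [add_comm T k]; exact h k
  have h3 := hbs.sum_le_tsum (Finset.range K) fun k _ => hb k
  linarith

/-- The product `R (s + m - 1) * ⋯ * R s`. -/
def transition [DecidableEq V] (R : ℕ → Matrix V V ℝ) (s : ℕ) : ℕ → Matrix V V ℝ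
  | 0 => 1
  | m + 1 => R (s + m) * transition R s m

/-- Perturbed averaging over jointly strongly connected graphs with square-summable perturbations
has square-summable disagreement. -/
theorem summable_spread_sq [Nonempty V] {G : ℕ → Digraph V} {Q : ℕ} (hQ : 0 < Q)
    (hconn : QStronglyConnected Q G) (hself : ∀ t i, (G t).Adj i i) {β : ℝ} (hβ : 0 < β)
    (hβ1 : β ≤ 1) {R : ℕ → Matrix V V ℝ} (hR0 : ∀ t i j, 0 ≤ R t i j)
    (hR1 : ∀ t i, ∑ j, R t i j = 1) (hRβ : ∀ t i j, (G t).Adj j i → β ≤ R t i j)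
    {x : ℕ → V → E} {ε : ℕ → ℝ} (hε : Antitone ε) (hεs : Summable fun k => ε k ^ 2)
    (hx : ∀ t i, ‖x (t + 1) i - ∑ j, R t i j • x t j‖ ≤ ε t) :
    Summable fun k => spread (x k) ^ 2 := by
  classical
  set Φ := transition R
  have hΦ0 : ∀ s m i j, 0 ≤ Φ s m i j := by
    intro s m
    induction m with
    | zero => intro i j; simp only [Φ, transition, Matrix.one_apply]; split_ifs <;> norm_num
    | succ m ih =>
      intro i j
      simp only [Φ, transition, Matrix.mul_apply]
      exact Finset.sum_nonneg fun l _ => mul_nonneg (hR0 _ _ _) (ih l j)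
  have hΦ1 : ∀ s m i, ∑ j, Φ s m i j = 1 := by
    intro s m
    induction m with
    | zero => intro i; simp [Φ, transition, Matrix.one_apply]
    | succ m ih =>
      intro i
      simp only [Φ, transition, Matrix.mul_apply]
      rw [Finset.sum_comm]
      simp only [← Finset.mul_sum]
      exact (Finset.sum_congr rfl fun l _ => by rw [ih l, mul_one]).trans (hR1 _ i)
  -- Row-stochastic averaging does not amplify earlier errors, and monotonicity of `ε` bounds each
  -- new one by `ε s`.
  have hΦx : ∀ s m i, ‖x (s + m) i - ∑ j, Φ s m i j • x s j‖ ≤ m * ε s := by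
    intro s m
    induction m with
    | zero => intro i; simp [Φ, transition, Matrix.one_apply]
    | succ m ih =>
      intro i
      have e : ∑ j, Φ s (m + 1) i j • x s j =
          ∑ l, R (s + m) i l • ∑ j, Φ s m l j • x s j := by
        simp only [Φ, transition, Matrix.mul_apply, Finset.sum_smul, Finset.smul_sum, mul_smul]
        exact Finset.sum_comm
      have e2 : x (s + (m + 1)) i - ∑ j, Φ s (m + 1) i j • x s j =
          (x (s + m + 1) i - ∑ l, R (s + m) i l • x (s + m) l) +
          (∑ l, R (s + m) i l • (x (s + m) l - ∑ j, Φ s m l j • x s j) - 0) := by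
        rw [e]; simp only [smul_sub, Finset.sum_sub_distrib]; rw [← add_assoc]; abel
      rw [e2]
      refine (norm_add_le _ _).trans ?_
      have h1 := hx (s + m) i
      have h2 : ε (s + m) ≤ ε s := hε (Nat.le_add_right s m)
      have h3 := norm_sum_smul_sub_le (hR0 (s + m) i) (hR1 (s + m) i) (u := 0)
        (x := fun l => x (s + m) l - ∑ j, Φ s m l j • x s j) fun l => by
          rw [sub_zero]; exact ih l
      push_cast
      linarith
  set T := (Fintype.card V + 1) * Q with hT
  set η := β ^ T with hη
  have hη0 : 0 < η := pow_pos hβ _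
  have hη1 : η ≤ 1 := pow_le_one₀ hβ.le hβ1
  -- Column `j` of the product starts with the value `1` at `j`, and that mass reaches every row.
  have hΦη : ∀ s i j, η ≤ Φ s T i j := by
    intro s i j
    have := pow_mul_le_of_qStronglyConnected hQ hconn hself hβ.le s
      (v := fun m i => Φ s m i j) (fun m i l hG => by
        simp only [Φ, transition, Matrix.mul_apply]
        exact (mul_le_mul_of_nonneg_right (hRβ _ _ _ hG) (hΦ0 s m l j)).trans
          (Finset.single_le_sum (f := fun l => R (s + m) i l * transition R s m l j)
            (fun l _ => mul_nonneg (hR0 _ _ _) (hΦ0 s m l j)) (Finset.mem_univ l))) i j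
    simpa [Φ, transition] using this
  have hε0 : ∀ k, 0 ≤ ε k := fun k =>
    (norm_nonneg _).trans (hx k (Classical.arbitrary V))
  have hspread : ∀ k, spread (x (k + T)) ≤ (1 - η) * spread (x k) + 2 * T * ε k := by
    intro k
    refine spread_le fun i j => ?_
    have h1 := hΦx k T i
    have h2 := hΦx k T j
    rw [norm_sub_rev] at h2
    have h3 := norm_sum_smul_sub_sum_smul_le_mul (hΦ0 k T i) (hΦ0 k T j) (hΦ1 k T i) (hΦ1 k T j)
      (norm_sub_le_spread (x k)) (Classical.arbitrary V) (hΦη k i _) (hΦη k j _)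
    have e : x (k + T) i - x (k + T) j = (x (k + T) i - ∑ l, Φ k T i l • x k l) +
      (∑ l, Φ k T i l • x k l - ∑ l, Φ k T j l • x k l) +
      (∑ l, Φ k T j l • x k l - x (k + T) j) := by abel
    rw [e]
    refine (norm_add₃_le ..).trans ?_
    linarith
  refine summable_of_delayed_contraction (T := T) (b := fun k => (2 * T) ^ 2 / η * ε k ^ 2)
    (fun k => sq_nonneg _) (fun k => by positivity) (hεs.mul_left _) hη0 fun k => ?_
  refine (pow_le_pow_left₀ (spread_nonneg _) (hspread k) 2).trans ?_
  set d := spread (x k)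
  set r := 2 * T * ε k with hr
  have h1 : (2 * (T : ℝ)) ^ 2 / η * ε k ^ 2 = r ^ 2 / η := by rw [hr]; ring
  -- The defect in Jensen's inequality for the square at the points `d` and `r / η` with weights `1
  -- - η` and `η`.
  have h2 : (1 - η) * d ^ 2 + r ^ 2 / η - ((1 - η) * d + r) ^ 2 =
      (1 - η) * (η * d - r) ^ 2 / η := by
    field_simp; ring
  have h3 : 0 ≤ (1 - η) * (η * d - r) ^ 2 / η :=
    div_nonneg (mul_nonneg (by linarith) (sq_nonneg _)) hη0.le
  rw [h1]
  linarith

/-- Push-sum with square-summable perturbations: the estimates stay close to the average of the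
numerators, with square-summable error. -/
theorem exists_pushSum_error [Nonempty V] {G : ℕ → Digraph V} {Q : ℕ} (hQ : 0 < Q)
    (hconn : QStronglyConnected Q G) (hself : ∀ t i, (G t).Adj i i) {ν : ℝ} (hν : 0 < ν)
    {W : ℕ → Matrix V V ℝ} (hcompl : ∀ t, Compliant (G t) (W t))
    (hcol : ∀ t j, ∑ i, W t i j = 1) (hlow : ∀ t i j, (G t).Adj j i → ν ≤ W t i j)
    {γ : ℕ → ℝ} (hγ0 : ∀ k, 0 < γ k) (hγ : Antitone γ) (hγs : Summable fun k => γ k ^ 2)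
    {q : ℕ → V → ℝ} {w g y z : ℕ → V → E} {L : ℝ} (hg : ∀ k i, ‖g (k + 1) i‖ ≤ L)
    (hq0 : ∀ i, q 0 i = 1) (hq : ∀ k i, q (k + 1) i = ∑ j, W k i j * q k j)
    (hw : ∀ k i, w (k + 1) i = ∑ j, W k i j • z k j)
    (hy : ∀ k i, y (k + 1) i = (q (k + 1) i)⁻¹ • w (k + 1) i)
    (hz : ∀ k i, z (k + 1) i = w (k + 1) i - γ k • g (k + 1) i) :
    ∃ D : ℕ → ℝ, (∀ k, 0 ≤ D k) ∧ Summable (fun k => D k ^ 2) ∧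
      ∀ k i, ‖y (k + 1) i - (Fintype.card V : ℝ)⁻¹ • ∑ j, z k j‖ ≤ D k := by
  classical
  have hW0 : ∀ t i j, 0 ≤ W t i j := fun t i j => by
    by_cases h : (G t).Adj j i
    · exact ((hcompl t i j).1 h).le
    · exact ((hcompl t i j).2 h).ge
  have hq_nonneg : ∀ k i, 0 ≤ q k i := by
    intro k
    induction k with
    | zero => intro i; rw [hq0]; exact zero_le_one
    | succ k ih =>
      intro i
      rw [hq]
      exact Finset.sum_nonneg fun j _ => mul_nonneg (hW0 k i j) (ih j)
  have hq_sum : ∀ k, ∑ i, q k i = Fintype.card V := by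
    intro k
    induction k with
    | zero => simp [hq0]
    | succ k ih =>
      simp only [hq]
      rw [Finset.sum_comm]
      simp only [← Finset.sum_mul, hcol, one_mul, ih]
  have hn : (1 : ℝ) ≤ Fintype.card V := by exact_mod_cast Fintype.card_pos
  have hν1 : ν ≤ 1 := by
    have i := Classical.arbitrary V
    exact (hlow 0 i i (hself 0 i)).trans ((Finset.single_le_sum (f := fun l => W 0 l i)
      (fun l _ => hW0 0 l i) (Finset.mem_univ i)).trans (hcol 0 i).le)
  have hq_step : ∀ k i j, (G k).Adj j i → ν * q k j ≤ q (k + 1) i := fun k i j h => by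
    rw [hq]
    exact (mul_le_mul_of_nonneg_right (hlow k i j h) (hq_nonneg k j)).trans
      (Finset.single_le_sum (f := fun j => W k i j * q k j)
        (fun l _ => mul_nonneg (hW0 k i l) (hq_nonneg k l)) (Finset.mem_univ j))
  set T := (Fintype.card V + 1) * Q with hT
  set δ := ν ^ T with hδ
  have hδ0 : 0 < δ := pow_pos hν _
  have hδ1 : δ ≤ 1 := pow_le_one₀ hν.le hν1
  -- The total mass is `card V`, so at time `k - T` some entry is at least `1`, and it spreads to
  -- all vertices in `T` steps. For `k ≤ T` the self-loops suffice.
  have hqδ : ∀ k i, δ ≤ q k i := by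
    intro k i
    rcases le_total T k with h | h
    · obtain ⟨j, -, hj⟩ := Finset.exists_le_of_sum_le (s := Finset.univ) (f := fun _ : V => (1 : ℝ))
        (g := q (k - T)) Finset.univ_nonempty (by rw [hq_sum]; simp)
      have := pow_mul_le_of_qStronglyConnected hQ hconn hself hν.le (k - T)
        (v := fun m => q (k - T + m)) (fun m i j h => hq_step _ i j h) i j
      rw [← hT, Nat.sub_add_cancel h, Nat.add_zero] at this
      nlinarith
    · have hk : ν ^ k ≤ q k i := by
        clear h
        induction k with
        | zero => simp [hq0]
        | succ k ih =>
          rw [pow_succ']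
          exact (mul_le_mul_of_nonneg_left ih hν.le).trans (hq_step k i i (hself k i))
      exact (pow_le_pow_of_le_one hν.le hν1 h).trans hk
  have hqpos : ∀ k i, 0 < q k i := fun k i => hδ0.trans_le (hqδ k i)
  have hqn : ∀ k i, q k i ≤ Fintype.card V := fun k i => by
    rw [← hq_sum k]
    exact Finset.single_le_sum (fun l _ => hq_nonneg k l) (Finset.mem_univ i)
  set x : ℕ → V → E := fun k i => (q k i)⁻¹ • z k i with hx
  -- Rescaling by `q` turns the column-stochastic `W` into a row-stochastic matrix acting on the
  -- ratios `z / q`.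
  set R : ℕ → Matrix V V ℝ := fun k => Matrix.of fun i j => (q (k + 1) i)⁻¹ * (W k i j * q k j)
    with hR
  have hR0 : ∀ k i j, 0 ≤ R k i j := fun k i j =>
    mul_nonneg (inv_nonneg.2 (hq_nonneg _ _)) (mul_nonneg (hW0 _ _ _) (hq_nonneg _ _))
  have hR1 : ∀ k i, ∑ j, R k i j = 1 := fun k i => by
    simp only [hR, Matrix.of_apply]
    rw [← Finset.mul_sum, ← hq, inv_mul_cancel₀ (hqpos _ _).ne']
  have hqx : ∀ k i, q k i • x k i = z k i := fun k i => smul_inv_smul₀ (hqpos k i).ne' _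
  have hyR : ∀ k i, y (k + 1) i = ∑ j, R k i j • x k j := fun k i => by
    simp only [hR, Matrix.of_apply, mul_smul, hqx]
    rw [hy, hw, Finset.smul_sum]
  set β := ν * δ / Fintype.card V with hβ
  have hn0 : (0 : ℝ) < Fintype.card V := by linarith
  have hRβ : ∀ k i j, (G k).Adj j i → β ≤ R k i j := fun k i j h => by
    simp only [hR, Matrix.of_apply]
    rw [hβ, div_eq_inv_mul]
    have h1 : (Fintype.card V : ℝ)⁻¹ ≤ (q (k + 1) i)⁻¹ := inv_anti₀ (hqpos _ _) (hqn _ _)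
    have h2 : ν * δ ≤ W k i j * q k j :=
      mul_le_mul (hlow k i j h) (hqδ k j) hδ0.le (hW0 k i j)
    exact mul_le_mul h1 h2 (by positivity) (inv_nonneg.2 (hq_nonneg _ _))
  have hβ1 : β ≤ 1 := by
    rw [hβ, div_le_one hn0]
    nlinarith
  have hL : 0 ≤ L := (norm_nonneg _).trans (hg 0 (Classical.arbitrary V))
  have hpert : ∀ k i, ‖x (k + 1) i - ∑ j, R k i j • x k j‖ ≤ L / δ * γ k := fun k i => by
    have e : x (k + 1) i - ∑ j, R k i j • x k j = -((q (k + 1) i)⁻¹ • γ k • g (k + 1) i) := by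
      rw [← hyR, hy]
      simp only [hx]
      rw [hz, smul_sub]
      abel
    rw [e, norm_neg, norm_smul, norm_smul, norm_inv, Real.norm_of_nonneg (hq_nonneg _ _),
      Real.norm_of_nonneg (hγ0 k).le, div_eq_inv_mul, mul_assoc, mul_comm L]
    exact mul_le_mul (inv_anti₀ hδ0 (hqδ _ _)) (mul_le_mul_of_nonneg_left (hg k i) (hγ0 k).le)
      (mul_nonneg (hγ0 k).le (norm_nonneg _)) (inv_nonneg.2 hδ0.le)
  refine ⟨fun k => spread (x k), fun k => spread_nonneg _, ?_, fun k i => ?_⟩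
  · refine summable_spread_sq hQ hconn hself (by positivity) hβ1 hR0 hR1 hRβ
      (hγ.const_mul (div_nonneg hL hδ0.le)) ?_ hpert
    simpa only [mul_pow] using hγs.mul_left ((L / δ) ^ 2)
  -- Both the average, with weights `q / card V`, and `y (k + 1) i`, with row `i` of `R`, are convex
  -- combinations of the ratios.
  · have e : (Fintype.card V : ℝ)⁻¹ • ∑ j, z k j =
        ∑ j, ((Fintype.card V : ℝ)⁻¹ * q k j) • x k j := by
      simp only [Finset.smul_sum, mul_smul, hqx]
    rw [hyR, e]
    exact norm_sum_smul_sub_sum_smul_le (hR0 k i)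
      (fun j => mul_nonneg (inv_nonneg.2 hn0.le) (hq_nonneg k j)) (hR1 k i)
      (by rw [← Finset.mul_sum, hq_sum, inv_mul_cancel₀ hn0.ne']) (norm_sub_le_spread (x k))

end Consensus

/-! ### Summable descent and Fejér convergence -/

section Descent

lemma tendsto_zero_of_summable_sq {D : ℕ → ℝ} (h0 : ∀ k, 0 ≤ D k)
    (h : Summable fun k => D k ^ 2) : Tendsto D atTop (𝓝 0) := by
  have := (Real.continuous_sqrt.tendsto 0).comp h.tendsto_atTop_zero
  rw [Real.sqrt_zero] at this
  exact this.congr fun k => Real.sqrt_sq (h0 k)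

lemma summable_mul_of_summable_sq {a b : ℕ → ℝ} (ha : Summable fun k => a k ^ 2)
    (hb : Summable fun k => b k ^ 2) (ha0 : ∀ k, 0 ≤ a k) (hb0 : ∀ k, 0 ≤ b k) :
    Summable fun k => a k * b k :=
  (ha.add hb).of_nonneg_of_le (fun k => mul_nonneg (ha0 k) (hb0 k)) fun k => by
    nlinarith [sq_nonneg (a k - b k), mul_nonneg (ha0 k) (hb0 k)]

/-- Deterministic form of the Robbins–Siegmund lemma. -/
lemma tendsto_and_summable_of_descent {v a b : ℕ → ℝ} (hv : ∀ k, 0 ≤ v k) (ha : ∀ k, 0 ≤ a k)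
    (hb : ∀ k, 0 ≤ b k) (hbs : Summable b) (h : ∀ k, v (k + 1) ≤ v k - a k + b k) :
    (∃ l, Tendsto v atTop (𝓝 l)) ∧ Summable a := by
  have hsum : ∀ K, ∑ k ∈ Finset.range K, b k ≤ ∑' k, b k := fun K =>
    hbs.sum_le_tsum _ fun k _ => hb k
  constructor
  -- Subtracting the accumulated errors makes the sequence monotone, and it stays bounded below.
  · have hanti : Antitone fun K => v K - ∑ k ∈ Finset.range K, b k :=
      antitone_nat_of_succ_le fun K => by
        rw [Finset.sum_range_succ]; linarith [h K, ha K]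
    have hbdd : BddBelow (Set.range fun K => v K - ∑ k ∈ Finset.range K, b k) :=
      ⟨-∑' k, b k, by rintro _ ⟨K, rfl⟩; dsimp only; linarith [hv K, hsum K]⟩
    have := (tendsto_atTop_ciInf hanti hbdd).add hbs.hasSum.tendsto_sum_nat
    exact ⟨_, this.congr fun K => by ring⟩
  · refine summable_of_sum_range_le (c := v 0 + ∑' k, b k) ha fun K => ?_
    have : ∑ k ∈ Finset.range K, a k ≤ v 0 - v K + ∑ k ∈ Finset.range K, b k := by
      induction K with
      | zero => simp
      | succ K ih => rw [Finset.sum_range_succ, Finset.sum_range_succ]; linarith [h K]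
    linarith [hv K, hsum K]

/-- Otherwise `γ ≤ ε⁻¹ * (γ * φ)` eventually, making `γ` summable. -/
lemma frequently_lt_of_summable_mul {γ φ : ℕ → ℝ} (hγ : ∀ k, 0 < γ k)
    (hγsum : Tendsto (fun K => ∑ k ∈ Finset.range K, γ k) atTop atTop)
    (h : Summable fun k => γ k * φ k) {ε : ℝ} (hε : 0 < ε) : ∃ᶠ k in atTop, φ k < ε := by
  intro hcon
  have hs : Summable γ := by
    refine Summable.of_norm_bounded_eventually_nat (h.mul_left ε⁻¹) ?_
    filter_upwards [hcon] with k hk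
    rw [Real.norm_of_nonneg (hγ k).le, le_inv_mul_iff₀ hε, mul_comm]
    exact mul_le_mul_of_nonneg_left (not_lt.1 hk) (hγ k).le
  exact not_tendsto_atTop_of_tendsto_nhds hs.hasSum.tendsto_sum_nat hγsum

/-- A sequence with convergent distances to all minimizers, along which the values are infinitely
often nearly optimal, converges to a minimizer. -/
lemma exists_tendsto_of_fejer {X : Type*} [NormedAddCommGroup X] [ProperSpace X] {φ : X → ℝ}
    (hφ : Continuous φ) {S : Set X} (hS : S.Nonempty) (hSφ : ∀ u, u ∈ S ↔ ∀ x, φ u ≤ φ x)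
    {d : X → X → ℝ} (hd : ∀ u, Continuous (d u)) (hd0 : ∀ u, d u u = 0)
    (hdle : ∀ u x, ‖x - u‖ ^ 2 ≤ d u x) {x : ℕ → X}
    (hlim : ∀ u ∈ S, ∃ l, Tendsto (fun k => d u (x k)) atTop (𝓝 l))
    (hfreq : ∀ u ∈ S, ∀ ε > 0, ∃ᶠ k in atTop, φ (x k) - φ u < ε) :
    ∃ u ∈ S, Tendsto x atTop (𝓝 u) := by
  obtain ⟨u₀, hu₀⟩ := hS
  obtain ⟨ψ, hψ, hlt⟩ := extraction_forall_of_frequently fun m : ℕ =>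
    hfreq u₀ hu₀ (1 / ((m : ℝ) + 1)) Nat.one_div_pos_of_nat
  obtain ⟨l, hl⟩ := hlim u₀ hu₀
  obtain ⟨B, hB⟩ := hl.bddAbove_range
  have hbd : ∀ k, x k ∈ Metric.closedBall u₀ (Real.sqrt B) := fun k => by
    rw [Metric.mem_closedBall, dist_eq_norm]
    exact Real.le_sqrt_of_sq_le ((hdle u₀ (x k)).trans (hB ⟨k, rfl⟩))
  obtain ⟨u, -, χ, hχ, hu⟩ :=
    tendsto_subseq_of_bounded Metric.isBounded_closedBall fun m => hbd (ψ m)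
  have hφu : φ u ≤ φ u₀ := by
    have h1 : Tendsto (fun m => φ (x (ψ (χ m))) - φ u₀) atTop (𝓝 (φ u - φ u₀)) :=
      ((hφ.tendsto u).comp hu).sub_const _
    have h2 := le_of_tendsto_of_tendsto h1
      (tendsto_one_div_add_atTop_nhds_zero_nat.comp hχ.tendsto_atTop)
      (Eventually.of_forall fun m => (hlt (χ m)).le)
    linarith
  have huS : u ∈ S := (hSφ u).2 fun y => hφu.trans ((hSφ u₀).1 hu₀ y)
  refine ⟨u, huS, ?_⟩
  -- The cluster point is itself a minimizer, so the distance to it converges along the whole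
  -- sequence; the subsequence shows that the limit is zero.
  obtain ⟨l', hl'⟩ := hlim u huS
  have h1 : Tendsto (fun m => d u (x (ψ (χ m)))) atTop (𝓝 (d u u)) :=
    ((hd u).tendsto u).comp hu
  have h2 := hl'.comp (hψ.comp hχ).tendsto_atTop
  rw [tendsto_nhds_unique h2 (hd0 u ▸ h1)] at hl'
  rw [tendsto_iff_norm_sub_tendsto_zero]
  have h3 := squeeze_zero (fun k => sq_nonneg _) (fun k => hdle u (x k)) hl'
  have h4 := (Real.continuous_sqrt.tendsto 0).comp h3
  rw [Real.sqrt_zero] at h4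
  exact h4.congr fun k => Real.sqrt_sq (norm_nonneg _)

end Descent

/-! ### Passing between blocks and agents -/

section Blocks

lemma norm_le_sum_norm {ι : Type*} [Fintype ι] {β : ι → Type*} [∀ i, NormedAddCommGroup (β i)]
    (x : PiLp 2 β) : ‖x‖ ≤ ∑ i, ‖x i‖ := by
  refine le_of_sq_le_sq ?_ (Finset.sum_nonneg fun i _ => norm_nonneg _)
  rw [PiLp.norm_sq_eq_of_L2]
  exact Finset.sum_sq_le_sq_sum_of_nonneg fun i _ => norm_nonneg _

lemma sum_subtype_eq_sum_dite {ι M : Type*} [Fintype ι] [AddCommMonoid M] (p : ι → Prop)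
    [DecidablePred p] (φ : (i : ι) → p i → M) :
    ∑ i : {i // p i}, φ i.1 i.2 = ∑ i, if h : p i then φ i h else 0 := by
  rw [← Fintype.sum_subtype_add_sum_subtype p fun i => if h : p i then φ i h else 0]
  have h1 : ∑ i : {i // ¬ p i}, (if h : p i.1 then φ i.1 h else 0) = 0 :=
    Finset.sum_eq_zero fun i _ => dif_neg i.2
  rw [h1, add_zero]
  exact Finset.sum_congr rfl fun i _ => (dif_pos i.2).symm

variable {N P : ℕ} {n : Fin P → ℕ} {EI EE : Finset (Fin P × Fin N)}

lemma sum_agents_eq_sum_blocks (φ : (p : Fin P) → (i : Fin N) → (p, i) ∈ EE → ℝ) :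
    ∑ p, ∑ i : Agents EE p, φ p i.1 i.2 = ∑ i, ∑ p : Blocks EE i, φ p.1 i p.2 := by
  rw [Finset.sum_congr rfl fun p _ => sum_subtype_eq_sum_dite (fun i => (p, i) ∈ EE) (φ p),
    Finset.sum_congr rfl fun i _ => sum_subtype_eq_sum_dite (fun p => (p, i) ∈ EE)
      fun p => φ p i, Finset.sum_comm]

/-- The blocks of `y` that agent `i` estimates. -/
def restrict (EE : Finset (Fin P × Fin N)) (i : Fin N) (y : Var n) : LocalVar n EE i :=
  WithLp.toLp 2 fun p => y p.1

/-- The extension by zero of a vector held by agent `i`. -/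
def extend {i : Fin N} (y : LocalVar n EE i) : Var n :=
  WithLp.toLp 2 fun p => if h : (p, i) ∈ EE then y ⟨p, h⟩ else 0

lemma norm_extend_sub {i : Fin N} (x y : LocalVar n EE i) :
    ‖extend x - extend y‖ = ‖x - y‖ := by
  rw [← sq_eq_sq₀ (norm_nonneg _) (norm_nonneg _), PiLp.norm_sq_eq_of_L2, PiLp.norm_sq_eq_of_L2]
  rw [sum_subtype_eq_sum_dite (fun p => (p, i) ∈ EE) fun p h => ‖(x - y) ⟨p, h⟩‖ ^ 2]
  refine Finset.sum_congr rfl fun p _ => ?_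
  by_cases h : (p, i) ∈ EE <;> simp [extend, h]

lemma continuous_restrict (i : Fin N) : Continuous (restrict (n := n) EE i) := by
  unfold restrict
  fun_prop

/-- The cost as a function of the estimated blocks is finite and Lipschitz. -/
lemma exists_estimateCost_eq (h : EI ⊆ EE) (f : (i : Fin N) → LocalVar n EI i → EReal) (i : Fin N)
    (hlsc : LowerSemicontinuous (fullCost f i)) (hproper : IsProper (fullCost f i))
    (hconv : IsConvex (fullCost f i)) {L : ℝ} (hL : 0 < L)
    (hbdd : ∀ y, ∀ g ∈ subdifferential (fullCost f i) y, ‖g‖ ≤ L) :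
    ∃ F : LocalVar n EE i → ℝ, (∀ y, estimateCost h f i y = F y) ∧
      ∀ x y, F x ≤ F y + L * ‖x - y‖ := by
  obtain ⟨F, hF, hlip⟩ := exists_real_lipschitz hlsc hproper hconv hL hbdd
  -- Since `EI ⊆ EE`, the cost never sees the blocks filled with zeros, and extension by zero
  -- preserves distances.
  refine ⟨fun y => F (extend y), fun y => ?_, fun x y => ?_⟩
  · rw [← hF]
    simp only [estimateCost, fullCost, extend]
    congr 2
    ext p
    simp [h p.2]
  · rw [← norm_extend_sub]; exact hlip _ _

/-- Test the subgradient inequality at `x + g`. This carries the bound over to subgradients in the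
estimated blocks, whereas the assumption concerns the whole variable. -/
lemma norm_le_of_lipschitz {X : Type*} [NormedAddCommGroup X] [InnerProductSpace ℝ X] {F : X → ℝ}
    {L : ℝ} (hL : 0 ≤ L) (hF : ∀ x y, F x ≤ F y + L * ‖x - y‖) {x g : X}
    (hg : ∀ z, F x + ⟪g, z - x⟫ ≤ F z) : ‖g‖ ≤ L := by
  have h1 := hg (x + g)
  have h2 := hF (x + g) x
  rw [add_sub_cancel_left] at h1 h2
  rw [real_inner_self_eq_norm_sq] at h1
  by_contra! hlt
  nlinarith

end Blocks

/-! ### One-step descent and the convergence theorem -/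

section Main

/-- The weight `card V` cancels the normalization of the averaged step, leaving the plain sum of the
inner products. -/
lemma card_mul_norm_sub_sq_le {E : Type*} [NormedAddCommGroup E] [InnerProductSpace ℝ E]
    {V : Type*} [Fintype V] [Nonempty V] {L γ : ℝ} {g : V → E} (hg : ∀ i, ‖g i‖ ≤ L) (x u : E) :
    (Fintype.card V : ℝ) * ‖x - γ • (Fintype.card V : ℝ)⁻¹ • ∑ i, g i - u‖ ^ 2 ≤
      (Fintype.card V : ℝ) * ‖x - u‖ ^ 2 - 2 * γ * ∑ i, ⟪g i, x - u⟫ +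
        γ ^ 2 * (Fintype.card V * L ^ 2) := by
  have hc : (0 : ℝ) < Fintype.card V := by exact_mod_cast Fintype.card_pos
  set c := (Fintype.card V : ℝ) with hcdef
  have hsum : ‖∑ i, g i‖ ≤ c * L := by
    refine (norm_sum_le_of_le _ fun i _ => hg i).trans_eq ?_
    simp [hcdef]
  have hsq : ‖∑ i, g i‖ ^ 2 ≤ (c * L) ^ 2 := pow_le_pow_left₀ (norm_nonneg _) hsum 2
  have e : x - γ • c⁻¹ • ∑ i, g i - u = (x - u) - (γ * c⁻¹) • ∑ i, g i := by
    rw [mul_smul]; abel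
  rw [e, norm_sub_sq_real, norm_smul, mul_pow, Real.norm_eq_abs, sq_abs, inner_smul_right,
    real_inner_comm, sum_inner]
  set I := ∑ i, ⟪g i, x - u⟫
  have h1 : c * (‖x - u‖ ^ 2 - 2 * (γ * c⁻¹ * I) + (γ * c⁻¹) ^ 2 * ‖∑ i, g i‖ ^ 2) =
      c * ‖x - u‖ ^ 2 - 2 * γ * I + γ ^ 2 * c⁻¹ * ‖∑ i, g i‖ ^ 2 := by
    field_simp
  have h2 : γ ^ 2 * c⁻¹ * ‖∑ i, g i‖ ^ 2 ≤ γ ^ 2 * c⁻¹ * (c * L) ^ 2 :=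
    mul_le_mul_of_nonneg_left hsq (by positivity)
  have h3 : γ ^ 2 * c⁻¹ * (c * L) ^ 2 = γ ^ 2 * (c * L ^ 2) := by
    field_simp
  rw [h1]
  linarith

/-- Comparing values through a subgradient at a nearby point. -/
lemma sub_le_inner_add_of_lipschitz {X : Type*} [NormedAddCommGroup X] [InnerProductSpace ℝ X]
    {F : X → ℝ} {L : ℝ} (hF : ∀ x y, F x ≤ F y + L * ‖x - y‖) {y g : X} (hgL : ‖g‖ ≤ L)
    (hg : ∀ z, F y + ⟪g, z - y⟫ ≤ F z) (x u : X) :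
    F x - F u ≤ ⟪g, x - u⟫ + 2 * L * ‖x - y‖ := by
  have h1 := hg u
  have h2 := hF x y
  have h3 := neg_le_of_abs_le (abs_real_inner_le_norm g (x - y))
  have h4 : ‖g‖ * ‖x - y‖ ≤ L * ‖x - y‖ := mul_le_mul_of_nonneg_right hgL (norm_nonneg _)
  have h5 : ⟪g, x - u⟫ = ⟪g, x - y⟫ - ⟪g, u - y⟫ := by
    rw [← inner_sub_right, sub_sub_sub_cancel_right]
  linarith

variable {N P : ℕ} {n : Fin P → ℕ} {EI EE : Finset (Fin P × Fin N)}

/-- The block-wise averages of the data of the agents. -/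
noncomputable def average (z : Estimates n EE) : Var n :=
  WithLp.toLp 2 fun p => (Fintype.card (Agents EE p) : ℝ)⁻¹ • ∑ i, z p i

/-- The squared distance in which block `p` has the weight `card (Agents EE p)`. -/
noncomputable def weightedSqDist (EE : Finset (Fin P × Fin N)) (u x : Var n) : ℝ :=
  ∑ p, (Fintype.card (Agents EE p) : ℝ) * ‖x p - u p‖ ^ 2

lemma mem_solutionSet_iff {f : (i : Fin N) → LocalVar n EI i → EReal} (h : EI ⊆ EE)
    {F : (i : Fin N) → LocalVar n EE i → ℝ} (hF : ∀ i y, estimateCost h f i y = F i y)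
    (u : Var n) : u ∈ solutionSet f ↔
      ∀ x : Var n, ∑ i, F i (restrict EE i u) ≤ ∑ i, F i (restrict EE i x) := by
  have hsum : ∀ x : Var n, ∑ i, fullCost f i x =
      ((∑ i, F i (restrict EE i x) : ℝ) : EReal) := fun x => by
    have hcoe := map_sum (⟨⟨Real.toEReal, EReal.coe_zero⟩, EReal.coe_add⟩ : ℝ →+ EReal)
      (fun i => F i (restrict EE i x)) Finset.univ
    exact (Finset.sum_congr rfl fun i _ => hF i (restrict EE i x)).trans hcoe.symm
  simp only [solutionSet, Set.mem_ofPred_eq, hsum, EReal.coe_le_coe_iff]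

/-- Expand block by block, regroup the cross terms by agent, and apply the subgradient inequality.
Each agent's subgradient is taken `∑ p, D p` away from the average at most and costs `2 * L` times
that; `N` agents and the factor `2 * γ` give `4 * N * L`. -/
lemma weightedSqDist_average_le [∀ p, Nonempty (Agents EE p)]
    {F : (i : Fin N) → LocalVar n EE i → ℝ} {L : ℝ} (hL : 0 ≤ L)
    (hF : ∀ i x y, F i x ≤ F i y + L * ‖x - y‖) {g y z z' : Estimates n EE} {γ : ℝ} (hγ : 0 < γ)
    (hg : ∀ i x, F i (agentPart y i) + ⟪agentPart g i, x - agentPart y i⟫ ≤ F i x)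
    (hz : average z' = average z - γ • average g) {D : Fin P → ℝ} (hD0 : ∀ p, 0 ≤ D p)
    (hD : ∀ p i, ‖y p i - average z p‖ ≤ D p) (u : Var n) :
    weightedSqDist EE u (average z') ≤ weightedSqDist EE u (average z) -
      2 * γ * (∑ i, F i (restrict EE i (average z)) - ∑ i, F i (restrict EE i u)) +
      (4 * N * L * (γ * ∑ p, D p) + γ ^ 2 * ∑ p, Fintype.card (Agents EE p) * L ^ 2) := by
  have hgL : ∀ i, ‖agentPart g i‖ ≤ L := fun i => norm_le_of_lipschitz hL (hF i) (hg i)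
  have hgp : ∀ p i, ‖g p i‖ ≤ L := fun p i =>
    (PiLp.norm_apply_le (agentPart g i.1) ⟨p, i.2⟩).trans (hgL i.1)
  have h1 : weightedSqDist EE u (average z') ≤ ∑ p,
      ((Fintype.card (Agents EE p) : ℝ) * ‖average z p - u p‖ ^ 2 -
        2 * γ * ∑ i, ⟪g p i, average z p - u p⟫ + γ ^ 2 * (Fintype.card (Agents EE p) * L ^ 2)) :=
    Finset.sum_le_sum fun p _ => by
      rw [hz]
      exact card_mul_norm_sub_sq_le (hgp p) (average z p) (u p)
  have h2 : ∑ p, ∑ i, ⟪g p i, average z p - u p⟫ =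
      ∑ i, ⟪agentPart g i, restrict EE i (average z) - restrict EE i u⟫ := by
    simp only [PiLp.inner_apply]
    exact sum_agents_eq_sum_blocks fun p i h => ⟪g p ⟨i, h⟩, average z p - u p⟫
  have h3 : ∀ i, ‖restrict EE i (average z) - agentPart y i‖ ≤ ∑ p, D p := fun i => by
    rw [norm_sub_rev]
    calc _ ≤ ∑ p : Blocks EE i, D p.1 :=
          (norm_le_sum_norm _).trans (Finset.sum_le_sum fun p _ => hD p.1 ⟨i, p.2⟩)
      _ = ∑ p, if (p, i) ∈ EE then D p else 0 := by
          rw [sum_subtype_eq_sum_dite (fun p => (p, i) ∈ EE) fun p _ => D p]; simp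
      _ ≤ _ := Finset.sum_le_sum fun p _ => by split_ifs; exacts [le_rfl, hD0 p]
  have h4 : ∑ i, F i (restrict EE i (average z)) - ∑ i, F i (restrict EE i u) ≤
      ∑ i, ⟪agentPart g i, restrict EE i (average z) - restrict EE i u⟫ +
        N * (2 * L * ∑ p, D p) := by
    have e : (N : ℝ) * (2 * L * ∑ p, D p) = ∑ _i : Fin N, 2 * L * ∑ p, D p := by simp
    rw [e, ← Finset.sum_sub_distrib, ← Finset.sum_add_distrib]
    refine Finset.sum_le_sum fun i _ =>
      (sub_le_inner_add_of_lipschitz (hF i) (hgL i) (hg i) _ _).trans ?_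
    gcongr
    exact h3 i
  refine h1.trans ?_
  rw [Finset.sum_add_distrib, Finset.sum_sub_distrib, ← Finset.mul_sum, ← Finset.mul_sum, h2]
  simp only [weightedSqDist]
  nlinarith [mul_le_mul_of_nonneg_left h4 hγ.le]

end Main

end END

theorem mainTheorem2 {N P : ℕ} (n : Fin P → ℕ)
    -- interference graph `EI` and estimate graph `EE ⊇ EI`
    (EI EE : Finset (Fin P × Fin N)) (hEI : ∀ p, ∃ i, (p, i) ∈ EI) (hsub : EI ⊆ EE)
    -- communication graphs `GC`, design graphs `GD` and their weight matrices
    (GC : ℕ → Digraph (Fin N))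
    (GD : ℕ → (p : Fin P) → Digraph (END.Agents EE p))
    (hGD : ∀ k p i j, (GD k p).Adj i j → (GC k).Adj i.1 j.1)
    (W : ℕ → (p : Fin P) → Matrix (END.Agents EE p) (END.Agents EE p) ℝ)
    (hW : ∀ k p, END.Compliant (GD k p) (W k p))
    (ν : ℝ) (hν : 0 < ν) (hcol : END.ColumnStochasticWeights ν GD W)
    (Q : ℕ) (hQ : 0 < Q) (hconn : ∀ p, END.QStronglyConnected Q fun k => GD k p)
    -- costs
    (f : (i : Fin N) → END.LocalVar n EI i → EReal)
    (hproper : ∀ i, END.IsProper (END.fullCost f i))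
    (hlsc : ∀ i, LowerSemicontinuous (END.fullCost f i))
    (hconv : ∀ i, END.IsConvex (END.fullCost f i))
    (hbdd : ∀ i, ∃ L : ℝ, 0 < L ∧
      ∀ y, ∀ g ∈ END.subdifferential (END.fullCost f i) y, ‖g‖ ≤ L)
    (hsol : (END.solutionSet f).Nonempty)
    -- step sizes
    (γ : ℕ → ℝ) (hγpos : ∀ k, 0 < γ k) (hγmono : Antitone γ)
    (hγsum : Tendsto (fun K => ∑ k ∈ Finset.range K, γ k) atTop atTop)
    (hγsq : Summable fun k => γ k ^ 2)
    -- the sequences generated by the algorithm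
    (q : ℕ → (p : Fin P) → END.Agents EE p → ℝ) (w g y z : ℕ → END.Estimates n EE)
    (halg : END.IsPushSum hsub f W γ q w g y z) :
    ∃ ystar ∈ END.solutionSet f, Tendsto y atTop (𝓝 (END.consensus EE ystar)) := by
  have hne : ∀ p, Nonempty (END.Agents EE p) := fun p =>
    (hEI p).elim fun i hi => ⟨⟨i, hsub hi⟩⟩
  have hcost : ∃ F : (i : Fin N) → END.LocalVar n EE i → ℝ, ∃ L : ℝ, 0 ≤ L ∧
      (∀ i y, END.estimateCost hsub f i y = F i y) ∧
        ∀ i x y, F i x ≤ F i y + L * ‖x - y‖ := by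
    choose L hL0 hL using hbdd
    choose F hF hlip using fun i =>
      END.exists_estimateCost_eq hsub f i (hlsc i) (hproper i) (hconv i) (hL0 i) (hL i)
    refine ⟨F, ∑ i, L i, Finset.sum_nonneg fun i _ => (hL0 i).le, hF, fun i x y => ?_⟩
    refine (hlip i x y).trans ?_
    gcongr
    exact Finset.single_le_sum (fun j _ => (hL0 j).le) (Finset.mem_univ i)
  obtain ⟨F, L, hL, hF, hlip⟩ := hcost
  have hg : ∀ k i x, F i (END.agentPart (y (k + 1)) i) +
      ⟪END.agentPart (g (k + 1)) i, x - END.agentPart (y (k + 1)) i⟫ ≤ F i x := fun k i x => by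
    have h := halg.g_succ k i x
    rw [hF, hF] at h
    exact_mod_cast h
  have hgL : ∀ k p i, ‖g (k + 1) p i‖ ≤ L := fun k p i =>
    (PiLp.norm_apply_le (END.agentPart (g (k + 1)) i.1) ⟨p, i.2⟩).trans
      (END.norm_le_of_lipschitz hL (hlip i.1) (hg k i.1))
  choose D hD0 hDs hD using fun p => END.exists_pushSum_error hQ (hconn p)
    (fun k i => hcol.self_loop k p i) hν (fun k => hW k p) (fun k j => hcol.col_sum k p j)
    (fun k i j h => hcol.lower_bound k p i j h) hγpos hγmono hγsq
    (q := fun k => q k p) (w := fun k => w k p) (g := fun k => g k p) (y := fun k => y k p)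
    (z := fun k => z k p) (fun k i => hgL k p i) (halg.q_zero p) (fun k i => halg.q_succ k p i)
    (fun k i => halg.w_succ k p i) (fun k i => halg.y_succ k p i) (fun k i => halg.z_succ k p i)
  have hz : ∀ k, END.average (z (k + 1)) =
      END.average (z k) - γ k • END.average (g (k + 1)) := fun k => by
    ext1 p
    have hw : ∑ i, w (k + 1) p i = ∑ i, z k p i := by
      simp only [halg.w_succ]
      rw [Finset.sum_comm]
      simp only [← Finset.sum_smul, hcol.col_sum, one_smul]
    simp only [END.average, PiLp.sub_apply, PiLp.smul_apply, halg.z_succ, Finset.sum_sub_distrib,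
      hw, smul_sub, ← Finset.smul_sum]
    rw [smul_comm]
  have hsolF := END.mem_solutionSet_iff hsub hF
  set φ : END.Var n → ℝ := fun x => ∑ i, F i (END.restrict EE i x) with hφ
  have hφc : Continuous φ := continuous_finsetSum _ fun i _ =>
    (LipschitzWith.of_le_add_mul' L fun x y => by
      rw [dist_eq_norm]; exact hlip i x y).continuous.comp (END.continuous_restrict i)
  have hdesc : ∀ u ∈ END.solutionSet f,
      (∃ l, Tendsto (fun k => END.weightedSqDist EE u (END.average (z k))) atTop (𝓝 l)) ∧
        Summable fun k => 2 * γ k * (φ (END.average (z k)) - φ u) := fun u hu => by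
    refine END.tendsto_and_summable_of_descent
      (fun k => Finset.sum_nonneg fun p _ => by positivity)
      (fun k => mul_nonneg (by linarith [hγpos k]) (sub_nonneg.2 ((hsolF u).1 hu _)))
      (fun k => ?_) ?_ fun k => END.weightedSqDist_average_le hL hlip (hγpos k) (hg k) (hz k)
        (fun p => hD0 p k) (fun p i => hD p k i) u
    · have := Finset.sum_nonneg fun p (_ : p ∈ Finset.univ) => hD0 p k
      have := hγpos k
      positivity
    · refine Summable.add (Summable.mul_left _ ?_) (hγsq.mul_right _)
      simp only [Finset.mul_sum]
      exact summable_sum fun p _ =>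
        END.summable_mul_of_summable_sq hγsq (hDs p) (fun k => (hγpos k).le) (hD0 p)
  obtain ⟨u, hu, hlim⟩ := END.exists_tendsto_of_fejer hφc hsol hsolF
    (d := END.weightedSqDist EE) (x := fun k => END.average (z k))
    (fun u => by unfold END.weightedSqDist; fun_prop)
    (fun u => by simp [END.weightedSqDist])
    (fun u x => by
      rw [PiLp.norm_sq_eq_of_L2]
      refine Finset.sum_le_sum fun p _ => le_mul_of_one_le_left (sq_nonneg _) ?_
      exact_mod_cast Fintype.card_pos)
    (fun u hu => (hdesc u hu).1)
    (fun u hu ε hε => END.frequently_lt_of_summable_mul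
      (fun k => mul_pos two_pos (hγpos k))
      (by simpa only [← Finset.mul_sum] using hγsum.const_mul_atTop two_pos) (hdesc u hu).2 hε)
  -- The initial `y 0` is unconstrained; the disagreement bound starts at `y 1`.
  refine ⟨u, hu, (tendsto_add_atTop_iff_nat 1).1 ?_⟩
  rw [tendsto_pi_nhds]
  intro p
  rw [tendsto_pi_nhds]
  intro i
  have hp : Tendsto (fun k => END.average (z k) p) atTop (𝓝 (u p)) :=
    ((PiLp.continuous_apply 2 _ p).tendsto u).comp hlim
  have hd := squeeze_zero_norm (fun k => hD p k i)
    (END.tendsto_zero_of_summable_sq (hD0 p) (hDs p))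
  have := hd.add hp
  rw [zero_add] at this
  exact this.congr fun k => sub_add_cancel _ _
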